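/- Work over $\mathbb{C}$. Let $X\subset\mathbb{P}^n$ be the closed subscheme scheme-theoretically defined by quadratic forms $F_0,\ldots,F_s\in S=\mathbb{C}[z_0,\ldots,z_n]$. Suppose that $F_0,\ldots,F_s$ satisfy condition $(K_2)$: the trivial (Koszul) relations $F_je_i-F_ie_j$ among the $F_i$ lie in the $S$-submodule of $S^{s+1}$ generated by the linear syzygies, i.e. by the vectors $(a_0,\ldots,a_s)$ of linear forms with $\sum_k a_kF_k=0$. Let $\mathrm{Sec}X\subset\mathbb{P}^n$ be the secant variety of $X$, that is, the closure of the union of $X$ and of all lines $L\subset\mathbb{P}^n$ such that the scheme-theoretic intersection $X\cap L$ has length at least two (possibly infinite). Then the rational map $\varphi=[F_0:\cdots:F_s]\colon\mathbb{P}^n\dashrightarrow\mathbb{P}^s$ is an embedding off $\mathrm{Sec}X$: it is defined on $\mathbb{P}^n\setminus\mathrm{Sec}X$, and its restriction $\mathbb{P}^n\setminus\mathrm{Sec}X\to\mathbb{P}^s$ is an immersion of schemes (an isomorphism onto a locally closed subscheme). -/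

import Mathlib

open AlgebraicGeometry CategoryTheory MvPolynomial

attribute [local instance] MvPolynomial.gradedAlgebra

namespace SecantEmbedding

noncomputable section

/-! ### The morphism of `Proj`s induced by a ring map multiplying degrees by `d` -/

section InducedMorphism

universe u

/-- `ψ` sends elements of degree `k` to elements of degree `d * k`. -/
def MultipliesDegree {A B σ τ : Type u} [CommRing A] [CommRing B] [SetLike σ A] [SetLike τ B]
    (𝒜 : ℕ → σ) (ℬ : ℕ → τ) (ψ : A →+* B) (d : ℕ) : Prop :=
  ∀ (k : ℕ) (a : A), a ∈ 𝒜 k → ψ a ∈ ℬ (d * k)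

variable {A B σ τ : Type u} [CommRing A] [CommRing B] [SetLike σ A] [SetLike τ B]
  [AddSubgroupClass σ A] [AddSubgroupClass τ B] {𝒜 : ℕ → σ} {ℬ : ℕ → τ}
  [GradedRing 𝒜] [GradedRing ℬ] {ψ : A →+* B} {d : ℕ}

/-- The map of localizations `A_t → B_{ψ t}` induced by `ψ`. -/
def localizationAwayMap (ψ : A →+* B) (t : A) :
    Localization.Away t →+* Localization.Away (ψ t) :=
  IsLocalization.Away.map (Localization.Away t) (Localization.Away (ψ t)) ψ t

theorem localizationAwayMap_mk (ψ : A →+* B) (t a : A) (i : ℕ) :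
    localizationAwayMap ψ t (Localization.mk a (⟨t ^ i, i, rfl⟩ : Submonoid.powers t)) =
      Localization.mk (ψ a) (⟨ψ t ^ i, i, rfl⟩ : Submonoid.powers (ψ t)) := by
  rw [Localization.mk_eq_mk', Localization.mk_eq_mk', localizationAwayMap,
    IsLocalization.Away.map, IsLocalization.map_mk']
  simp only [map_pow]

theorem exists_val_eq (hψ : MultipliesDegree 𝒜 ℬ ψ d) (t : A)
    (z : HomogeneousLocalization.Away 𝒜 t) :
    ∃ w : HomogeneousLocalization.Away ℬ (ψ t), w.val = localizationAwayMap ψ t z.val := by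
  obtain ⟨⟨n, ⟨a, ha⟩, ⟨b, hb⟩, j, hj⟩, rfl⟩ := HomogeneousLocalization.mk_surjective z
  obtain rfl : t ^ j = b := hj
  refine ⟨HomogeneousLocalization.mk ⟨d * n, ⟨ψ a, hψ n a ha⟩,
    ⟨ψ t ^ j, by simpa using hψ n _ hb⟩, j, rfl⟩, ?_⟩
  rw [HomogeneousLocalization.val_mk, HomogeneousLocalization.val_mk]
  exact (localizationAwayMap_mk ψ t a j).symm

/-- The map `(A_t)₀ → (B_{ψ t})₀`, `a / t ^ i ↦ ψ a / (ψ t) ^ i`, on degree zero parts. -/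
def awayMapOfDegree (hψ : MultipliesDegree 𝒜 ℬ ψ d) (t : A) :
    HomogeneousLocalization.Away 𝒜 t →+* HomogeneousLocalization.Away ℬ (ψ t) where
  toFun z := (exists_val_eq hψ t z).choose
  map_one' := HomogeneousLocalization.val_injective _ <| by
    rw [(exists_val_eq hψ t 1).choose_spec]; simp
  map_mul' x y := HomogeneousLocalization.val_injective _ <| by
    rw [(exists_val_eq hψ t (x * y)).choose_spec, HomogeneousLocalization.val_mul,
      HomogeneousLocalization.val_mul, map_mul, (exists_val_eq hψ t x).choose_spec,
      (exists_val_eq hψ t y).choose_spec]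
  map_zero' := HomogeneousLocalization.val_injective _ <| by
    rw [(exists_val_eq hψ t 0).choose_spec]; simp
  map_add' x y := HomogeneousLocalization.val_injective _ <| by
    rw [(exists_val_eq hψ t (x + y)).choose_spec, HomogeneousLocalization.val_add,
      HomogeneousLocalization.val_add, map_add, (exists_val_eq hψ t x).choose_spec,
      (exists_val_eq hψ t y).choose_spec]

theorem val_awayMapOfDegree (hψ : MultipliesDegree 𝒜 ℬ ψ d) (t : A)
    (z : HomogeneousLocalization.Away 𝒜 t) :
    (awayMapOfDegree hψ t z).val = localizationAwayMap ψ t z.val :=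
  (exists_val_eq hψ t z).choose_spec

theorem awayMapOfDegree_mk (hψ : MultipliesDegree 𝒜 ℬ ψ d) {t : A} {m : ℕ} (ht : t ∈ 𝒜 m)
    (i : ℕ) (a : A) (ha : a ∈ 𝒜 (i • m)) :
    awayMapOfDegree hψ t (HomogeneousLocalization.Away.mk 𝒜 ht i a ha) =
      HomogeneousLocalization.Away.mk ℬ (hψ m t ht) i (ψ a)
        (by have := hψ _ a ha; simpa [mul_left_comm] using this) := by
  apply HomogeneousLocalization.val_injective
  rw [val_awayMapOfDegree, HomogeneousLocalization.Away.val_mk,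
    HomogeneousLocalization.Away.val_mk]
  exact localizationAwayMap_mk ψ t a i

theorem awayMap_comp_awayMapOfDegree (hψ : MultipliesDegree 𝒜 ℬ ψ d) {t t' : A} {m m' : ℕ}
    (ht : t ∈ 𝒜 m) (ht' : t' ∈ 𝒜 m') :
    (HomogeneousLocalization.awayMap ℬ (hψ m' t' ht') (map_mul ψ t t')).comp
        (awayMapOfDegree hψ t) =
      (awayMapOfDegree hψ (t * t')).comp (HomogeneousLocalization.awayMap 𝒜 ht' rfl) := by
  ext z
  obtain ⟨i, a, ha, rfl⟩ := HomogeneousLocalization.Away.mk_surjective 𝒜 ht z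
  simp only [RingHom.comp_apply]
  rw [awayMapOfDegree_mk, HomogeneousLocalization.awayMap_mk, HomogeneousLocalization.awayMap_mk,
    awayMapOfDegree_mk]
  simp [HomogeneousLocalization.Away.val_mk]

/-- The chart `D₊(ψ t) ≅ Spec (B_{ψ t})₀ ⟶ Spec (A_t)₀ ≅ D₊(t) ⊆ Proj A` of the morphism induced
by `ψ`. -/
def chartMap (hψ : MultipliesDegree 𝒜 ℬ ψ d) {t : A} {m : ℕ} (ht : t ∈ 𝒜 m) (hm : 0 < m) :
    (Proj.basicOpen ℬ (ψ t)).toScheme ⟶ Proj 𝒜 :=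
  Proj.basicOpenToSpec ℬ (ψ t) ≫ Spec.map (CommRingCat.ofHom (awayMapOfDegree hψ t)) ≫
    Proj.awayι 𝒜 t ht hm

theorem homOfLE_chartMap (hψ : MultipliesDegree 𝒜 ℬ ψ d) {t t' : A} {m m' : ℕ}
    (ht : t ∈ 𝒜 m) (hm : 0 < m) (ht' : t' ∈ 𝒜 m')
    (h : Proj.basicOpen ℬ (ψ (t * t')) ≤ Proj.basicOpen ℬ (ψ t)) :
    (Proj ℬ).homOfLE h ≫ chartMap hψ ht hm =
      chartMap hψ (SetLike.mul_mem_graded ht ht') (Nat.add_pos_left hm m') := by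
  rw [chartMap, chartMap, ← Proj.SpecMap_awayMap_awayι 𝒜 ht hm ht' rfl,
    ← Spec.map_comp_assoc, ← CommRingCat.ofHom_comp, ← awayMap_comp_awayMapOfDegree hψ ht ht',
    CommRingCat.ofHom_comp, Spec.map_comp_assoc,
    Proj.basicOpenToSpec_SpecMap_awayMap_assoc]

theorem chartMap_compat (hψ : MultipliesDegree 𝒜 ℬ ψ d) {t t' : A} {m m' : ℕ}
    (ht : t ∈ 𝒜 m) (hm : 0 < m) (ht' : t' ∈ 𝒜 m') (hm' : 0 < m') {U : (Proj ℬ).Opens}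
    (hU : U = Proj.basicOpen ℬ (ψ t) ⊓ Proj.basicOpen ℬ (ψ t'))
    (h : U ≤ Proj.basicOpen ℬ (ψ t)) (h' : U ≤ Proj.basicOpen ℬ (ψ t')) :
    (Proj ℬ).homOfLE h ≫ chartMap hψ ht hm = (Proj ℬ).homOfLE h' ≫ chartMap hψ ht' hm' := by
  obtain rfl : U = Proj.basicOpen ℬ (ψ (t * t')) := by
    rw [hU, map_mul, Proj.basicOpen_mul]
  rw [homOfLE_chartMap hψ ht hm ht' h]
  have key : ∀ (s : A) (_ : t' * t = s) (hs : s ∈ 𝒜 (m + m'))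
      (h'' : Proj.basicOpen ℬ (ψ s) ≤ Proj.basicOpen ℬ (ψ t')),
      chartMap hψ hs (Nat.add_pos_left hm m') =
        (Proj ℬ).homOfLE h'' ≫ chartMap hψ ht' hm' := by
    rintro s rfl hs h''
    rw [homOfLE_chartMap hψ ht' hm' ht h'']
    rfl
  exact key _ (mul_comm t' t) _ h'

theorem chartMap_pullback (hψ : MultipliesDegree 𝒜 ℬ ψ d) {t t' : A} {m m' : ℕ}
    (ht : t ∈ 𝒜 m) (hm : 0 < m) (ht' : t' ∈ 𝒜 m') (hm' : 0 < m') {V : (Proj ℬ).Opens}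
    (h : Proj.basicOpen ℬ (ψ t) ≤ V) (h' : Proj.basicOpen ℬ (ψ t') ≤ V) :
    Limits.pullback.fst ((Proj ℬ).homOfLE h) ((Proj ℬ).homOfLE h') ≫ chartMap hψ ht hm =
      Limits.pullback.snd ((Proj ℬ).homOfLE h) ((Proj ℬ).homOfLE h') ≫ chartMap hψ ht' hm' := by
  rw [← cancel_epi (isPullback_opens_inf_le h h').isoPullback.hom,
    IsPullback.isoPullback_hom_fst_assoc, IsPullback.isoPullback_hom_snd_assoc]
  exact chartMap_compat hψ ht hm ht' hm' rfl _ _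

/-- The morphism `⋃ᵢ D₊(ψ yᵢ) ⟶ Proj A` induced by `ψ`, glued from its charts. -/
def inducedMorphism {ι : Type} (hψ : MultipliesDegree 𝒜 ℬ ψ d) (y : ι → A) {m : ι → ℕ}
    (hy : ∀ i, y i ∈ 𝒜 (m i)) (hm : ∀ i, 0 < m i) :
    (⨆ i, Proj.basicOpen ℬ (ψ (y i))).toScheme ⟶ Proj 𝒜 :=
  (Scheme.Opens.iSupOpenCover fun i => Proj.basicOpen ℬ (ψ (y i))).glueMorphisms
    (fun i => chartMap hψ (hy i) (hm i)) <| by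
    intro i j
    exact chartMap_pullback hψ (hy i) (hm i) (hy j) (hm j)
      (le_iSup (fun i => Proj.basicOpen ℬ (ψ (y i))) i)
      (le_iSup (fun i => Proj.basicOpen ℬ (ψ (y i))) j)

theorem homOfLE_inducedMorphism {ι : Type} (hψ : MultipliesDegree 𝒜 ℬ ψ d) (y : ι → A)
    {m : ι → ℕ} (hy : ∀ i, y i ∈ 𝒜 (m i)) (hm : ∀ i, 0 < m i) (i : ι) :
    (Proj ℬ).homOfLE (le_iSup (fun i => Proj.basicOpen ℬ (ψ (y i))) i) ≫
      inducedMorphism hψ y hy hm = chartMap hψ (hy i) (hm i) :=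
  (Scheme.Opens.iSupOpenCover fun i => Proj.basicOpen ℬ (ψ (y i))).ι_glueMorphisms _ _ i

end InducedMorphism

/-! ### Projective space and its closed subschemes -/

/-- The polynomial ring `ℂ[z₀, …, zₙ]`. -/
abbrev PolyRing (n : ℕ) : Type := MvPolynomial (Fin (n + 1)) ℂ

/-- The grading of `ℂ[z₀, …, zₙ]` by degree. -/
abbrev grading (n : ℕ) : ℕ → Submodule ℂ (PolyRing n) := homogeneousSubmodule (Fin (n + 1)) ℂ

/-- Complex projective space `ℙⁿ = Proj ℂ[z₀, …, zₙ]`. -/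
abbrev PSpace (n : ℕ) : Scheme.{0} := Proj (grading n)

/-- The structure morphism `ℙⁿ ⟶ Spec ℂ`. -/
def structureMap (n : ℕ) : PSpace n ⟶ Spec (.of ℂ) :=
  Proj.toSpecZero (grading n) ≫ Spec.map (CommRingCat.ofHom (algebraMap ℂ (grading n 0)))

theorem X_mem (n : ℕ) (i : Fin (n + 1)) : (X i : PolyRing n) ∈ grading n 1 :=
  (mem_homogeneousSubmodule 1 _).2 (isHomogeneous_X ℂ i)

/-- The standard affine chart `D₊(zᵢ)` of `ℙⁿ`. -/
def stdChart (n : ℕ) (i : Fin (n + 1)) : (PSpace n).affineOpens :=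
  ⟨Proj.basicOpen (grading n) (X i),
    Proj.isAffineOpen_basicOpen (grading n) (X i) (X_mem n i) one_pos⟩

/-- The dehomogenization `G / zᵢ ^ d`, a function on `D₊(zᵢ)`, of a form `G` of degree `d`. -/
def dehomogenize {n d : ℕ} {G : PolyRing n} (hG : G.IsHomogeneous d) (i : Fin (n + 1)) :
    Γ(PSpace n, (stdChart n i).1) :=
  (Proj.awayToSection (grading n) (X i)).hom
    (HomogeneousLocalization.Away.mk (grading n) (X_mem n i) d G
      ((mem_homogeneousSubmodule _ _).2 (by simpa using hG)))

/-- The ideal sheaf of the closed subscheme of `ℙⁿ` cut out by the forms belonging to `S`: the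
smallest quasi-coherent ideal sheaf which contains, on each chart `D₊(zᵢ)`, the dehomogenizations
`G / zᵢ ^ d` of the forms `G ∈ S`. Closed subschemes are given by their ideal sheaves, so that
`I ≤ J` means that the subscheme of `J` is contained in the one of `I`, and `I ⊔ J` is the ideal
sheaf of the scheme-theoretic intersection. -/
def cutOutBy {n : ℕ} (S : Set (PolyRing n)) : (PSpace n).IdealSheafData :=
  sInf {I | ∀ (d : ℕ) (G : PolyRing n) (hG : G.IsHomogeneous d), G ∈ S →
    ∀ i : Fin (n + 1), dehomogenize hG i ∈ I.ideal (stdChart n i)}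

/-- The linear subspace `ℙ(W) ⊆ ℙⁿ` (of lines through the origin in `W ⊆ ℂⁿ⁺¹`), as a
closed subscheme. -/
def linearSubscheme {n : ℕ} (W : Submodule ℂ (Fin (n + 1) → ℂ)) : (PSpace n).IdealSheafData :=
  cutOutBy {l | l.IsHomogeneous 1 ∧ ∀ w ∈ W, eval w l = 0}

/-- The closed subscheme `Z` of `ℙⁿ` is finite of length `m`: it is the image of a closed immersion
`Spec R ⟶ ℙⁿ` over `ℂ` with `dim_ℂ R = m`. -/
def HasLength {n : ℕ} (Z : (PSpace n).IdealSheafData) (m : ℕ) : Prop :=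
  ∃ (R : Type) (_ : CommRing R) (_ : Algebra ℂ R) (i : Spec (.of R) ⟶ PSpace n),
    IsClosedImmersion i ∧
    i ≫ structureMap n = Spec.map (CommRingCat.ofHom (algebraMap ℂ R)) ∧
    Module.Finite ℂ R ∧ Module.finrank ℂ R = m ∧ i.ker = Z

/-- The closed subscheme `Y` of `ℙⁿ` has length at least `m` (possibly infinite): it contains a
finite closed subscheme of length `m`. -/
def LengthAtLeast {n : ℕ} (Y : (PSpace n).IdealSheafData) (m : ℕ) : Prop :=
  ∃ Z : (PSpace n).IdealSheafData, Y ≤ Z ∧ HasLength Z m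

/-- The secant variety of `X ⊆ ℙⁿ`: the closure of the union of `X` and of all lines `L` (defined
over `ℂ`) whose scheme-theoretic intersection with `X` has length at least two. -/
def secantVariety {n : ℕ} (X : (PSpace n).IdealSheafData) : TopologicalSpace.Closeds (PSpace n) :=
  TopologicalSpace.Closeds.closure
    ((X.support : Set (PSpace n)) ∪
      ⋃ (W : Submodule ℂ (Fin (n + 1) → ℂ)) (_ : Module.finrank ℂ W = 2)
        (_ : LengthAtLeast (X ⊔ linearSubscheme W) 2),
        ((linearSubscheme W).support : Set (PSpace n)))

/-! ### Condition `(K_d)` and the rational map defined by forms of degree `d` -/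

/-- The linear syzygies among `F₀, …, Fₛ`. -/
def linearSyzygies {n s : ℕ} (F : Fin (s + 1) → PolyRing n) : Set (Fin (s + 1) → PolyRing n) :=
  {a | (∀ k, (a k).IsHomogeneous 1) ∧ ∑ k, a k * F k = 0}

/-- The trivial (Koszul) relation `Fⱼ eᵢ - Fᵢ eⱼ`. -/
def koszulSyzygy {n s : ℕ} (F : Fin (s + 1) → PolyRing n) (i j : Fin (s + 1)) :
    Fin (s + 1) → PolyRing n :=
  Pi.single i (F j) - Pi.single j (F i)

/-- Condition `(K_d)`: `F₀, …, Fₛ` are forms of degree `d` whose trivial relations lie in the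
submodule of `ℂ[z₀, …, zₙ]ˢ⁺¹` generated by the linear syzygies. -/
structure ConditionK {n s : ℕ} (d : ℕ) (F : Fin (s + 1) → PolyRing n) : Prop where
  isHomogeneous : ∀ k, (F k).IsHomogeneous d
  koszul_mem : ∀ i j, koszulSyzygy F i j ∈ Submodule.span (PolyRing n) (linearSyzygies F)

theorem multipliesDegree_aeval {n s d : ℕ} {F : Fin (s + 1) → PolyRing n}
    (hF : ∀ k, (F k).IsHomogeneous d) :
    MultipliesDegree (grading s) (grading n) (aeval F : PolyRing s →ₐ[ℂ] PolyRing n).toRingHom d := by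
  intro k a ha
  exact (mem_homogeneousSubmodule _ _).2 (((mem_homogeneousSubmodule _ _).1 ha).aeval F hF)

/-- The open set `⋃ᵢ D₊(Fᵢ)` of `ℙⁿ` where the forms `F₀, …, Fₛ` do not all vanish. -/
def nonvanishing {n s : ℕ} (F : Fin (s + 1) → PolyRing n) : (PSpace n).Opens :=
  ⨆ i, Proj.basicOpen (grading n) (aeval F (X i : PolyRing s))

/-- The morphism `φ = [F₀ : … : Fₛ]` from `⋃ᵢ D₊(Fᵢ) ⊆ ℙⁿ` to `ℙˢ`, induced by `yᵢ ↦ Fᵢ`. -/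
def phi {n s d : ℕ} (F : Fin (s + 1) → PolyRing n) (hF : ∀ k, (F k).IsHomogeneous d) :
    (nonvanishing F).toScheme ⟶ PSpace s :=
  inducedMorphism (multipliesDegree_aeval hF) (fun i => (X i : PolyRing s)) (X_mem s) fun _ => one_pos

end

end SecantEmbedding

open SecantEmbedding

/-!
Every linear syzygy `a` of `F₀, …, Fₛ` can be written `∑ₖ aₖ(z) yₖ = r(y) · z` with a row `r(y)` of
linear forms on `ℂˢ⁺¹`, and `r(F(z)) · z = 0`. Choose `n` linear syzygies and let `P(y)` be the
vector of maximal minors of the resulting `n × (n + 1)` matrix. By Cramer's rule `P(F(z))` is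
proportional to `z` (`aeval_syzygyMinor_mul_comm`), so `P` is a rational inverse of
`φ = [F₀ : … : Fₛ]` wherever it is defined. More precisely, over the affine open set of `ℙˢ` where
`t(y) = yₖ Fₖ(P(y))` does not vanish, the map of coordinate rings given by `φ` is surjective
(`awayMapOfDegree_surjective`). Hence the restriction of `φ` to the union of the open sets
`D₊(t(F))` is an immersion (`isImmersion_homOfLE_inducedMorphism`).

It remains to see that these open sets cover the complement of the secant variety
(`mem_secantVariety`). By the Nullstellensatz it suffices to consider a vector `x ∈ ℂⁿ⁺¹` at which
all `t(F)` vanish and some `Fₖ` does not. Then all the vectors `P(F(x))` are zero, so the rows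
`r(F(x))` have, besides `x`, an independent common zero `u`
(`exists_orthogonal_of_syzygyMinor_eq_zero`). As the trivial relations are generated by linear
syzygies, `F(v)` is proportional to `F(x)` for all `v` on the line through `x` and `u`
(`ConditionK.aeval_mul_comm`). Thus the line meets `X` in the zero scheme of a single nonzero binary
quadratic form, `Spec ℂ[T] / (Fₖ(u + T x))`, of length two (`lengthAtLeast_two`), and `x` lies on a
secant line.
-/

namespace SecantEmbedding

/-! ### Maximal minors of an `n × (n + 1)` matrix -/

section MaximalMinor

variable {R : Type*} [CommRing R] {n : ℕ}

/-- The signed maximal minor of an `n × (n + 1)` matrix obtained by deleting column `j`, written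
as the determinant of the matrix bordered by the `j`-th unit vector. -/
def maximalMinor (N : Fin n → Fin (n + 1) → R) (j : Fin (n + 1)) : R :=
  (Matrix.of (Fin.cons (Pi.single j 1) N : Fin (n + 1) → Fin (n + 1) → R)).det

/-- The matrix bordered by the row `v` sends `z` to `(v · z, 0, …, 0)`; multiply by its adjugate,
whose first column consists of the maximal minors. -/
theorem det_cons_mul {N : Fin n → Fin (n + 1) → R} {z : Fin (n + 1) → R}
    (hz : ∀ r, ∑ j, N r j * z j = 0) (v : Fin (n + 1) → R) (j : Fin (n + 1)) :
    (Matrix.of (Fin.cons v N : Fin (n + 1) → Fin (n + 1) → R)).det * z j =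
      maximalMinor N j * ∑ i, v i * z i := by
  set A : Matrix (Fin (n + 1)) (Fin (n + 1)) R :=
    Matrix.of (Fin.cons v N : Fin (n + 1) → Fin (n + 1) → R) with hA
  have h1 : A.mulVec z = Pi.single 0 (∑ i, v i * z i) := by
    ext r
    refine Fin.cases ?_ (fun r => ?_) r
    · simp [A, Matrix.mulVec, dotProduct]
    · simpa [A, Matrix.mulVec, dotProduct] using hz r
  have h2 : A.adjugate j 0 = maximalMinor N j := by
    rw [Matrix.adjugate_apply, maximalMinor]
    congr 1
    ext r c
    refine Fin.cases ?_ (fun r => ?_) r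
    · simp
    · simp [A]
  have h3 := congrFun (congrArg (A.adjugate.mulVec ·) h1) j
  simpa [Matrix.mulVec_mulVec, Matrix.adjugate_mul, Matrix.smul_mulVec, h2] using h3

/-- A vector killed by an `n × (n + 1)` matrix is proportional to the vector of its maximal
minors (Cramer's rule). -/
theorem maximalMinor_mul_comm {N : Fin n → Fin (n + 1) → R} {z : Fin (n + 1) → R}
    (hz : ∀ r, ∑ j, N r j * z j = 0) (i j : Fin (n + 1)) :
    maximalMinor N i * z j = maximalMinor N j * z i := by
  have h : ∑ k, (Pi.single i 1 : Fin (n + 1) → R) k * z k = z i := by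
    simp [Pi.single_apply]
  rw [← h]
  exact det_cons_mul hz (Pi.single i 1) j

theorem map_maximalMinor {S : Type*} [CommRing S] (f : R →+* S) (N : Fin n → Fin (n + 1) → R)
    (j : Fin (n + 1)) : f (maximalMinor N j) = maximalMinor (fun r c => f (N r c)) j := by
  rw [maximalMinor, maximalMinor, RingHom.map_det]
  congr 1
  ext r c
  refine Fin.cases ?_ (fun r => ?_) r
  · simp [Pi.single_apply, apply_ite f]
  · simp

theorem isHomogeneous_maximalMinor {K σ : Type*} [CommRing K]
    {N : Fin n → Fin (n + 1) → MvPolynomial σ K} (hN : ∀ r c, (N r c).IsHomogeneous 1)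
    (j : Fin (n + 1)) : (maximalMinor N j).IsHomogeneous n := by
  rw [maximalMinor, Matrix.det_apply]
  refine IsHomogeneous.sum _ _ _ fun τ _ => ?_
  rw [Units.smul_def, zsmul_eq_mul, ← map_intCast (C : K →+* MvPolynomial σ K)]
  refine IsHomogeneous.C_mul ?_ _
  have h : ∑ i, (Fin.cons 0 fun _ => 1 : Fin (n + 1) → ℕ) (τ i) = n := by
    rw [Equiv.sum_comp τ, Fin.sum_univ_succ]
    simp
  conv => arg 2; rw [← h]
  refine IsHomogeneous.prod _ _ _ fun c _ => ?_
  generalize τ c = r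
  refine Fin.cases ?_ (fun r => ?_) r
  · simp only [Matrix.of_apply, Fin.cons_zero, Pi.single_apply]
    split_ifs
    · exact isHomogeneous_one _ _
    · exact isHomogeneous_zero _ _ _
  · simpa using hN r c

/-- Either a nonzero vector orthogonal to `l` is orthogonal to all of `T`, or `l` can be completed
by members of `T` to a basis. -/
theorem exists_orthogonal_or_linearIndependent {K : Type*} [Field K]
    (T : Set (Fin (n + 1) → K)) {l : Fin (n + 1) → K} (hl : l ≠ 0) :
    (∃ u : Fin (n + 1) → K, u ≠ 0 ∧ ∑ i, l i * u i = 0 ∧ ∀ r ∈ T, ∑ i, r i * u i = 0) ∨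
      ∃ N : Fin n → Fin (n + 1) → K, (∀ r, N r ∈ T) ∧
        LinearIndependent K (Fin.cons l N : Fin (n + 1) → Fin (n + 1) → K) := by
  refine or_iff_not_imp_left.2 fun hT => ?_
  have key : ∀ k ≤ n, ∃ N : Fin k → Fin (n + 1) → K, (∀ r, N r ∈ T) ∧
      LinearIndependent K (Fin.cons l N : Fin (k + 1) → Fin (n + 1) → K) := by
    intro k
    induction k with
    | zero =>
      intro _
      refine ⟨Fin.elim0, fun r => r.elim0, ?_⟩
      rw [linearIndependent_finCons]
      refine ⟨linearIndependent_empty_type, ?_⟩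
      simpa [Set.range_eq_empty] using hl
    | succ k ih =>
      intro hk
      obtain ⟨N, hN, hli⟩ := ih (by omega)
      -- `k + 1 < n + 1` equations have a nonzero common solution
      obtain ⟨u, hu, hu0⟩ := Submodule.exists_mem_ne_zero_of_ne_bot
        (LinearMap.ker_ne_bot_of_finrank_lt (f := Matrix.mulVecLin
          (Matrix.of (Fin.cons l N : Fin (k + 1) → Fin (n + 1) → K))) (by simpa using hk))
      have hu' : ∀ r, ∑ i, (Fin.cons l N : Fin (k + 1) → Fin (n + 1) → K) r i * u i = 0 :=
        fun r => congrFun (LinearMap.mem_ker.1 hu) r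
      have : ∃ r ∈ T, ∑ i, r i * u i ≠ 0 := by
        by_contra! h
        exact hT ⟨u, hu0, by simpa using hu' 0, h⟩
      obtain ⟨r, hr, hru⟩ := this
      refine ⟨Fin.snoc N r, fun i => ?_, ?_⟩
      · refine Fin.lastCases ?_ (fun i => ?_) i
        · simpa using hr
        · simpa using hN i
      · rw [Fin.cons_snoc_eq_snoc_cons, linearIndependent_finSnoc]
        refine ⟨hli, fun hmem => hru ?_⟩
        have hle : Submodule.span K (Set.range (Fin.cons l N : Fin (k + 1) → Fin (n + 1) → K)) ≤
            LinearMap.ker ((dotProductBilin K K).flip u) := by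
          rw [Submodule.span_le]
          rintro _ ⟨i, rfl⟩
          exact hu' i
        exact hle hmem
  exact key n le_rfl

end MaximalMinor

/-! ### Values of forms at proportional vectors and on lines -/

section Forms

variable {K R : Type*} [CommRing K] [CommRing R] [Algebra K R] {σ : Type*}

theorem _root_.MvPolynomial.IsHomogeneous.aeval_smul {G : MvPolynomial σ K} {d : ℕ}
    (hG : G.IsHomogeneous d) (c : R) (z : σ → R) : aeval (fun i => c * z i) G = c ^ d * aeval z G := by
  rw [aeval_def, aeval_def, eval₂_eq, eval₂_eq, Finset.mul_sum]
  refine Finset.sum_congr rfl fun m hm => ?_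
  have hd : ∑ i ∈ m.support, m i = d := (hG.degree_eq_sum_deg_support hm).symm
  simp only [mul_pow]
  rw [Finset.prod_mul_distrib, Finset.prod_pow_eq_pow_sum, hd]
  ring

/-- Forms of the same degree take proportional values at proportional vectors. -/
theorem _root_.MvPolynomial.IsHomogeneous.aeval_mul_comm [IsDomain R] {G H : MvPolynomial σ K}
    {d : ℕ} (hG : G.IsHomogeneous d) (hH : H.IsHomogeneous d) {z P : σ → R}
    (h : ∀ i j, P i * z j = P j * z i) (hz : z ≠ 0) :
    aeval z G * aeval P H = aeval z H * aeval P G := by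
  obtain ⟨i, hi⟩ := Function.ne_iff.1 hz
  have hv : (fun j => z i * P j) = fun j => P i * z j := by
    ext j
    rw [h i j, mul_comm]
  have e1 : z i ^ d * aeval P G = P i ^ d * aeval z G := by
    rw [← IsHomogeneous.aeval_smul hG, ← IsHomogeneous.aeval_smul hG, hv]
  have e2 : z i ^ d * aeval P H = P i ^ d * aeval z H := by
    rw [← IsHomogeneous.aeval_smul hH, ← IsHomogeneous.aeval_smul hH, hv]
  refine mul_left_cancel₀ (pow_ne_zero d hi) ?_
  linear_combination aeval z G * e2 - aeval z H * e1

theorem _root_.MvPolynomial.IsHomogeneous.eq_sum_C_mul_X [Fintype σ] {l : MvPolynomial σ K}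
    (hl : l.IsHomogeneous 1) :
    l = ∑ j, C (coeff (Finsupp.single j 1) l) * X j := by
  classical
  ext m
  rw [coeff_sum]
  simp only [coeff_C_mul, coeff_X]
  by_cases hm : m.degree = 1
  · obtain ⟨j, rfl⟩ := (Finsupp.sum_eq_one_iff m).1 hm
    simp [Finsupp.single_left_inj]
  · rw [hl.coeff_eq_zero hm, Finset.sum_eq_zero]
    intro j _
    rw [if_neg, mul_zero]
    rintro rfl
    exact hm (by simp)

/-- Restricted to the parametrized line `T ↦ w + T x`, a form of degree `d` becomes a polynomial
of degree at most `d` whose coefficient of `T ^ d` is the value at `x`. -/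
theorem _root_.MvPolynomial.IsHomogeneous.aeval_line {G : MvPolynomial σ K} {d : ℕ}
    (hG : G.IsHomogeneous d) (w x : σ → K) :
    (aeval (fun j => Polynomial.C (w j) + Polynomial.C (x j) * Polynomial.X) G).natDegree ≤ d ∧
      (aeval (fun j => Polynomial.C (w j) + Polynomial.C (x j) * Polynomial.X) G).coeff d =
        eval x G := by
  have hlin : ∀ j, (Polynomial.C (w j) + Polynomial.C (x j) * Polynomial.X).natDegree ≤ 1 := by
    intro j
    compute_degree
  have hpow : ∀ j k,
      ((Polynomial.C (w j) + Polynomial.C (x j) * Polynomial.X) ^ k).natDegree ≤ k ∧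
      ((Polynomial.C (w j) + Polynomial.C (x j) * Polynomial.X) ^ k).coeff k = x j ^ k := by
    intro j k
    constructor
    · simpa using Polynomial.natDegree_pow_le_of_le k (hlin j)
    · have := Polynomial.coeff_pow_of_natDegree_le (m := k) (hlin j)
      simpa using this
  have hprod : ∀ (s : Finset σ) (m : σ → ℕ),
      (∏ j ∈ s, (Polynomial.C (w j) + Polynomial.C (x j) * Polynomial.X) ^ m j).natDegree ≤
        ∑ j ∈ s, m j ∧
      (∏ j ∈ s, (Polynomial.C (w j) + Polynomial.C (x j) * Polynomial.X) ^ m j).coeff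
        (∑ j ∈ s, m j) = ∏ j ∈ s, x j ^ m j := by
    classical
    intro s m
    induction s using Finset.induction_on with
    | empty => simp
    | insert j s hj ih =>
      rw [Finset.prod_insert hj, Finset.sum_insert hj, Finset.prod_insert hj]
      refine ⟨Polynomial.natDegree_mul_le_of_le (hpow j _).1 ih.1, ?_⟩
      rw [Polynomial.coeff_mul_add_eq_of_natDegree_le (hpow j _).1 ih.1, (hpow j _).2, ih.2]
  rw [aeval_def, eval₂_eq, eval_eq]
  constructor
  · refine Polynomial.natDegree_sum_le_of_forall_le _ _ fun m hm => ?_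
    rw [Polynomial.algebraMap_eq]
    refine (Polynomial.natDegree_C_mul_le _ _).trans ((hprod _ _).1.trans ?_)
    exact (hG.degree_eq_sum_deg_support hm).symm.le
  · rw [Polynomial.finsetSum_coeff]
    refine Finset.sum_congr rfl fun m hm => ?_
    rw [Polynomial.algebraMap_eq, Polynomial.coeff_C_mul, ← (hprod _ _).2,
      ← (show ∑ i ∈ m.support, m i = d from (hG.degree_eq_sum_deg_support hm).symm)]

end Forms

/-! ### The matrix of linear syzygies -/

section Syzygies

variable {n s : ℕ} {F : Fin (s + 1) → PolyRing n}

/-- The row `r(y)` of linear forms on `ℂˢ⁺¹` such that `r(y) · z = ∑ₖ aₖ(z) yₖ`, for a vector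
`a = (a₀, …, aₛ)` of linear forms on `ℂⁿ⁺¹`. -/
noncomputable def syzygyRow (a : Fin (s + 1) → PolyRing n) (j : Fin (n + 1)) : PolyRing s :=
  ∑ k, C (coeff (Finsupp.single j 1) (a k)) * X k

theorem isHomogeneous_syzygyRow (a : Fin (s + 1) → PolyRing n) (j : Fin (n + 1)) :
    (syzygyRow a j).IsHomogeneous 1 :=
  IsHomogeneous.sum _ _ _ fun k _ => (isHomogeneous_X ℂ k).C_mul _

theorem sum_aeval_syzygyRow_mul {R : Type*} [CommRing R] [Algebra ℂ R]
    {a : Fin (s + 1) → PolyRing n} (ha : ∀ k, (a k).IsHomogeneous 1) (y : Fin (s + 1) → R)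
    (v : Fin (n + 1) → R) :
    ∑ j, aeval y (syzygyRow a j) * v j = ∑ k, aeval v (a k) * y k := by
  have h : ∀ k, aeval v (a k) * y k =
      ∑ j, algebraMap ℂ R (coeff (Finsupp.single j 1) (a k)) * v j * y k := by
    intro k
    conv_lhs => rw [(ha k).eq_sum_C_mul_X]
    simp [Finset.sum_mul]
  simp only [h, syzygyRow, map_sum, Finset.sum_mul, map_mul, aeval_C, aeval_X]
  rw [Finset.sum_comm]
  refine Finset.sum_congr rfl fun k _ => Finset.sum_congr rfl fun j _ => ?_
  ring

/-- The maximal minors of the matrix whose rows belong to `n` vectors of linear forms: forms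
of degree `n` on `ℂˢ⁺¹`, which define a partial inverse of `[F₀ : … : Fₛ]` if these vectors are
linear syzygies. -/
noncomputable def syzygyMinor (a : Fin n → Fin (s + 1) → PolyRing n) (j : Fin (n + 1)) :
    PolyRing s :=
  maximalMinor (fun r => syzygyRow (a r)) j

theorem isHomogeneous_syzygyMinor (a : Fin n → Fin (s + 1) → PolyRing n) (j : Fin (n + 1)) :
    (syzygyMinor a j).IsHomogeneous n :=
  isHomogeneous_maximalMinor (fun r c => isHomogeneous_syzygyRow (a r) c) j

theorem aeval_syzygyMinor {R : Type*} [CommRing R] [Algebra ℂ R]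
    (a : Fin n → Fin (s + 1) → PolyRing n) (y : Fin (s + 1) → R) (j : Fin (n + 1)) :
    aeval y (syzygyMinor a j) = maximalMinor (fun r c => aeval y (syzygyRow (a r) c)) j :=
  map_maximalMinor (aeval y : PolyRing s →ₐ[ℂ] R).toRingHom _ j

/-- The vector of minors evaluated at `F(v)` is proportional to `v`: the rows of linear syzygies
at `F(v)` annihilate `v`. -/
theorem aeval_syzygyMinor_mul_comm {R : Type*} [CommRing R] [Algebra ℂ R]
    {a : Fin n → Fin (s + 1) → PolyRing n} (ha : ∀ r, a r ∈ linearSyzygies F)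
    (v : Fin (n + 1) → R) (i j : Fin (n + 1)) :
    aeval (fun k => aeval v (F k)) (syzygyMinor a i) * v j =
      aeval (fun k => aeval v (F k)) (syzygyMinor a j) * v i := by
  rw [aeval_syzygyMinor, aeval_syzygyMinor]
  refine maximalMinor_mul_comm (fun r => ?_) i j
  rw [sum_aeval_syzygyRow_mul (ha r).1]
  simpa using congrArg (aeval v) (ha r).2

/-- The form `Fₖ(P)` on `ℂˢ⁺¹`, where `P` is the vector of maximal minors. -/
noncomputable def minorForm (F : Fin (s + 1) → PolyRing n) (a : Fin n → Fin (s + 1) → PolyRing n)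
    (k : Fin (s + 1)) : PolyRing s :=
  aeval (syzygyMinor a) (F k)

theorem minorForm_mem (hF : ∀ k, (F k).IsHomogeneous 2) (a : Fin n → Fin (s + 1) → PolyRing n)
    (k : Fin (s + 1)) : minorForm F a k ∈ grading s (n * 2) :=
  (mem_homogeneousSubmodule _ _).2 ((hF k).aeval _ (isHomogeneous_syzygyMinor a))

theorem aeval_aeval_syzygyMinor {R : Type*} [CommRing R] [Algebra ℂ R] (y : Fin (s + 1) → R)
    (a : Fin n → Fin (s + 1) → PolyRing n) (G : PolyRing n) :
    aeval y (aeval (syzygyMinor a) G) = aeval (fun j => aeval y (syzygyMinor a j)) G := by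
  rw [← AlgHom.comp_apply, comp_aeval]

/-- The identity `G(z) Fₖ(P(F(z))) ^ e = Fₖ(z) ^ e G(P(F(z)))` of polynomials in `z`, which writes
`G` in terms of `F` up to powers of `Fₖ` and `Fₖ(P(F))`. -/
theorem mul_aeval_minorForm_pow (hF : ∀ k, (F k).IsHomogeneous 2)
    {a : Fin n → Fin (s + 1) → PolyRing n} (ha : ∀ r, a r ∈ linearSyzygies F) (k : Fin (s + 1))
    {G : PolyRing n} {e : ℕ} (hG : G.IsHomogeneous (2 * e)) :
    G * aeval F (minorForm F a k) ^ e = F k ^ e * aeval F (aeval (syzygyMinor a) G) := by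
  have h := hG.aeval_mul_comm ((hF k).pow e) (z := (X : Fin (n + 1) → PolyRing n))
    (P := fun j => aeval F (syzygyMinor a j))
    (by simpa using aeval_syzygyMinor_mul_comm ha (X : Fin (n + 1) → PolyRing n))
    (fun h => X_ne_zero (0 : Fin (n + 1)) (congrFun h 0))
  rw [minorForm, aeval_aeval_syzygyMinor, aeval_aeval_syzygyMinor]
  simpa only [aeval_X_left_apply, map_pow] using h

/-- On the chart `yₖ Fₖ(P(y)) ≠ 0` of `ℙˢ`, the map of coordinate rings given by `F` is
surjective: `G / ψ(t) ^ i` comes from `yₖ ^ (2e) G(P(y)) / t ^ (i + e)`, where `deg G = 2e`. -/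
theorem awayMapOfDegree_surjective (hF : ∀ k, (F k).IsHomogeneous 2)
    {a : Fin n → Fin (s + 1) → PolyRing n} (ha : ∀ r, a r ∈ linearSyzygies F)
    (k : Fin (s + 1)) :
    Function.Surjective
      (awayMapOfDegree (multipliesDegree_aeval hF) (X k * minorForm F a k)) := by
  intro z
  have ht := SetLike.mul_mem_graded (X_mem s k) (minorForm_mem hF a k)
  obtain ⟨i, G, hG, rfl⟩ := HomogeneousLocalization.Away.mk_surjective (grading n)
    (multipliesDegree_aeval hF _ _ ht) z
  set e : ℕ := i * (1 + n * 2) with he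
  have hG' : G.IsHomogeneous (2 * e) := by
    have : i • (2 * (1 + n * 2)) = 2 * e := by rw [he, smul_eq_mul]; ring
    exact (mem_homogeneousSubmodule _ _).1 (this ▸ hG)
  have hb : X k ^ (2 * e) * aeval (syzygyMinor a) G ∈ grading s ((i + e) • (1 + n * 2)) := by
    have h1 : (i + e) • (1 + n * 2) = 1 * (2 * e) + n * (2 * e) := by
      rw [smul_eq_mul, add_mul, ← he]; ring
    rw [h1, mem_homogeneousSubmodule]
    exact ((isHomogeneous_X ℂ k).pow _).mul (hG'.aeval _ (isHomogeneous_syzygyMinor a))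
  refine ⟨HomogeneousLocalization.Away.mk (grading s) ht (i + e) _ hb, ?_⟩
  rw [awayMapOfDegree_mk]
  apply HomogeneousLocalization.val_injective
  rw [HomogeneousLocalization.Away.val_mk, HomogeneousLocalization.Away.val_mk,
    Localization.mk_eq_mk_iff, Localization.r_iff_exists]
  refine ⟨1, ?_⟩
  have key := mul_aeval_minorForm_pow hF ha k hG'
  simp only [AlgHom.toRingHom_eq_coe, RingHom.coe_coe, map_mul, map_pow, aeval_X,
    OneMemClass.coe_one, one_mul]
  rw [pow_add _ i e, mul_pow _ _ e]
  linear_combination (-(F k * aeval F (minorForm F a k)) ^ i * F k ^ e) * key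

/-- Where all the minors vanish, the matrix of linear syzygies has corank at least two. -/
theorem exists_orthogonal_of_syzygyMinor_eq_zero {x : Fin (n + 1) → ℂ} {i : Fin (n + 1)}
    (hi : x i ≠ 0)
    (h : ∀ a : Fin n → Fin (s + 1) → PolyRing n, (∀ r, a r ∈ linearSyzygies F) → ∀ j,
      aeval (fun k => aeval x (F k)) (syzygyMinor a j) = 0) :
    ∃ u : Fin (n + 1) → ℂ, u ≠ 0 ∧ u i = 0 ∧ ∀ a ∈ linearSyzygies F,
      ∑ k, aeval u (a k) * aeval x (F k) = 0 := by
  obtain ⟨u, hu, hui, huT⟩ | ⟨N, hN, hli⟩ := exists_orthogonal_or_linearIndependent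
    ((fun a j => aeval (fun k => aeval x (F k)) (syzygyRow a j)) '' linearSyzygies F)
    (l := Pi.single i 1) (by simp)
  · refine ⟨u, hu, by simpa [Pi.single_apply] using hui, fun a ha => ?_⟩
    rw [← sum_aeval_syzygyRow_mul ha.1]
    exact huT _ ⟨a, ha, rfl⟩
  · exfalso
    choose a ha hNa using hN
    obtain rfl : (fun r j => aeval (fun k => aeval x (F k)) (syzygyRow (a r) j)) = N := funext hNa
    have hz : ∀ r, ∑ j, aeval (fun k => aeval x (F k)) (syzygyRow (a r) j) * x j = 0 := fun r => by
      rw [sum_aeval_syzygyRow_mul (ha r).1]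
      simpa using congrArg (aeval x) (ha r).2
    have hdet := det_cons_mul hz (Pi.single i 1) i
    rw [← aeval_syzygyMinor, h a ha, zero_mul] at hdet
    have hdet0 := (mul_eq_zero.1 hdet).resolve_right hi
    have hunit := (Matrix.isUnit_iff_isUnit_det _).1
      (Matrix.linearIndependent_rows_iff_isUnit.1
        (show LinearIndependent ℂ (Matrix.of _).row from hli))
    exact hunit.ne_zero hdet0

/-- Under condition `(K_d)`, if all linear syzygies pair to zero with `y` at `v`, then the vector
`F(v)` is proportional to `y`. -/
theorem ConditionK.aeval_mul_comm {d : ℕ} (hK : ConditionK d F) {R : Type*} [CommRing R]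
    [Algebra ℂ R] {v : Fin (n + 1) → R} {y : Fin (s + 1) → R}
    (h : ∀ a ∈ linearSyzygies F, ∑ k, aeval v (a k) * y k = 0) (i j : Fin (s + 1)) :
    aeval v (F i) * y j = aeval v (F j) * y i := by
  have key : ∀ b ∈ Submodule.span (PolyRing n) (linearSyzygies F),
      ∑ k, aeval v (b k) * y k = 0 := by
    intro b hb
    induction hb using Submodule.span_induction with
    | mem b hb => exact h b hb
    | zero => simp
    | add b c _ _ hb hc => simp [add_mul, Finset.sum_add_distrib, hb, hc]
    | smul p b _ hb => simp [mul_assoc, ← Finset.mul_sum, hb]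
  have := key _ (hK.koszul_mem j i)
  simp only [koszulSyzygy, Pi.sub_apply, map_sub, sub_mul, Finset.sum_sub_distrib,
    Pi.single_apply, apply_ite (aeval v), map_zero, ite_mul, zero_mul, Finset.sum_ite_eq',
    Finset.mem_univ, if_true] at this
  exact sub_eq_zero.1 this

end Syzygies

/-! ### Points of projective space with values in an algebra -/

section Points

variable {n : ℕ} {R : Type} [CommRing R] [Algebra ℂ R] {v : Fin (n + 1) → R} {l : PolyRing n}

/-- Evaluation `G / l ^ m ↦ G(v)` at a vector `v` with `l(v) = 1`. -/
noncomputable def evalAway (hv : aeval v l = 1) :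
    HomogeneousLocalization.Away (grading n) l →+* R :=
  (IsLocalization.Away.lift (S := Localization.Away l) l
    (g := (aeval v : PolyRing n →ₐ[ℂ] R).toRingHom)
    (by simp [hv])).comp
    (algebraMap (HomogeneousLocalization.Away (grading n) l) (Localization.Away l))

theorem evalAway_mk (hv : aeval v l = 1) {d : ℕ} (hl : l ∈ grading n d) (m : ℕ) (G : PolyRing n)
    (hG : G ∈ grading n (m • d)) :
    evalAway hv (HomogeneousLocalization.Away.mk (grading n) hl m G hG) = aeval v G := by
  rw [evalAway, RingHom.comp_apply, HomogeneousLocalization.algebraMap_apply,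
    HomogeneousLocalization.Away.val_mk, Localization.mk_eq_mk', IsLocalization.Away.lift,
    IsLocalization.lift_mk'_spec]
  simp [hv]

/-- The `R`-valued point `[v₀ : … : vₙ]` of `ℙⁿ`, where `l(v) = 1` for some linear form `l`. -/
noncomputable def pointMap (hl : l ∈ grading n 1) (hv : aeval v l = 1) :
    Spec (.of R) ⟶ PSpace n :=
  Spec.map (CommRingCat.ofHom (evalAway hv)) ≫ Proj.awayι (grading n) l hl one_pos

variable (hl : l ∈ grading n 1) (hv : aeval v l = 1)

theorem pointMap_structureMap :
    pointMap hl hv ≫ structureMap n = Spec.map (CommRingCat.ofHom (algebraMap ℂ R)) := by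
  rw [pointMap, structureMap, Category.assoc, Proj.awayι_toSpecZero_assoc, ← Spec.map_comp,
    ← Spec.map_comp, ← CommRingCat.ofHom_comp, ← CommRingCat.ofHom_comp]
  congr 2
  ext c
  have h : HomogeneousLocalization.fromZeroRingHom (grading n) (.powers l)
      (algebraMap ℂ (grading n 0) c) = HomogeneousLocalization.Away.mk (grading n) hl 0 (C c)
        (by simp) := by
    apply HomogeneousLocalization.val_injective
    rw [HomogeneousLocalization.Away.val_mk]
    simp [HomogeneousLocalization.fromZeroRingHom]
    rfl
  simp only [RingHom.comp_apply, h, evalAway_mk]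
  simp

theorem pointMap_preimage_basicOpen {f : PolyRing n} {d : ℕ} (hf : f ∈ grading n d) (hd : 0 < d) :
    pointMap hl hv ⁻¹ᵁ Proj.basicOpen (grading n) f = PrimeSpectrum.basicOpen (aeval v f) := by
  rw [pointMap, Scheme.Hom.comp_preimage,
    Proj.awayι_preimage_basicOpen (grading n) hl one_pos hf hd]
  have : evalAway hv (HomogeneousLocalization.Away.isLocalizationElem hl hf) = aeval v f := by
    rw [evalAway_mk, pow_one]
  rw [← this]
  rfl

theorem appLE_comp_ι {Y Z : Scheme} (U : Y.Opens) (g : Z ⟶ U.toScheme) (h : ⊤ ≤ (g ≫ U.ι) ⁻¹ᵁ U) :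
    (g ≫ U.ι).appLE U ⊤ h = U.topIso.inv ≫ g.appTop := by
  rw [← Scheme.Hom.appLE_comp_appLE g U.ι U ⊤ ⊤ (by simp) le_rfl]
  congr 1
  · rw [Scheme.Opens.ι_appLE]
    rfl
  · exact Scheme.Hom.appLE_eq_app g

/-- On functions on `D₊(l)`, the point `[v₀ : … : vₙ]` acts as evaluation at `v`. -/
theorem awayToSection_pointMap_appLE
    (h : ⊤ ≤ pointMap hl hv ⁻¹ᵁ Proj.basicOpen (grading n) l) :
    Proj.awayToSection (grading n) l ≫
        (pointMap hl hv).appLE (Proj.basicOpen (grading n) l) ⊤ h =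
      CommRingCat.ofHom (evalAway hv) ≫ (Scheme.ΓSpecIso (.of R)).inv := by
  have e : Proj.awayToSection (grading n) l = (Scheme.ΓSpecIso _).inv ≫
      (Proj.basicOpenToSpec (grading n) l).appTop ≫ (Proj.basicOpen (grading n) l).topIso.hom := by
    rw [Scheme.Hom.appTop, Proj.basicOpenToSpec_app_top]
    erw [Category.assoc, Category.assoc, Iso.inv_hom_id, Category.comp_id, Iso.inv_hom_id_assoc]
  have hfac : pointMap hl hv = (Spec.map (CommRingCat.ofHom (evalAway hv)) ≫
      (Proj.basicOpenIsoSpec (grading n) l hl one_pos).inv) ≫ (Proj.basicOpen (grading n) l).ι := by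
    rw [pointMap, Proj.awayι, Category.assoc]
  have hinv : (Proj.basicOpenToSpec (grading n) l).appTop ≫
      (Proj.basicOpenIsoSpec (grading n) l hl one_pos).inv.appTop = 𝟙 _ := by
    rw [← Proj.basicOpenIsoSpec_hom (grading n) l hl one_pos, ← Scheme.Hom.comp_appTop,
      Iso.inv_hom_id, Scheme.Hom.id_appTop]
  have key : (pointMap hl hv).appLE (Proj.basicOpen (grading n) l) ⊤ h =
      (Proj.basicOpen (grading n) l).topIso.inv ≫
        (Proj.basicOpenIsoSpec (grading n) l hl one_pos).inv.appTop ≫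
          (Spec.map (CommRingCat.ofHom (evalAway hv))).appTop := by
    simp only [hfac]
    rw [appLE_comp_ι, Scheme.Hom.comp_appTop]
  rw [key, e]
  simp only [Category.assoc, Iso.hom_inv_id_assoc]
  rw [← Category.assoc (Scheme.Hom.appTop _) (Scheme.Hom.appTop _), hinv, Category.id_comp,
    Scheme.ΓSpecIso_inv_naturality]

theorem pointMap_preimage_basicOpen_self :
    pointMap hl hv ⁻¹ᵁ Proj.basicOpen (grading n) l = ⊤ := by
  rw [pointMap_preimage_basicOpen hl hv hl one_pos, hv]
  exact PrimeSpectrum.basicOpen_one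

/-- The closed image of the point `[v₀ : … : vₙ]` is contained in the hypersurface `G = 0`
if `G(v) = 0`. -/
theorem dehomogenize_mem_ker {G : PolyRing n} {d : ℕ} (hG : G.IsHomogeneous d)
    (hGv : aeval v G = 0) (j : Fin (n + 1)) :
    dehomogenize hG j ∈ (pointMap hl hv).ker.ideal (stdChart n j) := by
  rw [Scheme.Hom.ker_apply, RingHom.mem_ker]
  set i := pointMap hl hv
  set V := i ⁻¹ᵁ Proj.basicOpen (grading n) (X j)
  have htop : ⊤ ≤ i ⁻¹ᵁ Proj.basicOpen (grading n) l :=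
    (pointMap_preimage_basicOpen_self hl hv).ge
  have hV : V ≤ i ⁻¹ᵁ Proj.basicOpen (grading n) (X j * l) := by
    rw [Proj.basicOpen_mul]
    exact le_inf le_rfl (le_top.trans htop)
  -- on the overlap of the charts, `G / zⱼ ^ d = (G / l ^ d) * (l / zⱼ) ^ d`, where `l / zⱼ` is
  -- written as `l ^ 2 / (zⱼ l)`
  let ρ := Proj.awayToSection (grading n) (X j * l) ≫ i.appLE _ V hV
  have e1 : Proj.awayToSection (grading n) (X j) ≫ i.app (Proj.basicOpen (grading n) (X j)) =
      CommRingCat.ofHom (HomogeneousLocalization.awayMap (grading n) hl rfl) ≫ ρ := by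
    rw [Proj.awayMap_awayToSection_assoc, Scheme.Hom.map_appLE, Scheme.Hom.app_eq_appLE]
  have e2 : CommRingCat.ofHom (HomogeneousLocalization.awayMap (grading n) (X_mem n j)
      (mul_comm (X j) l)) ≫ ρ = CommRingCat.ofHom (evalAway hv) ≫ (Scheme.ΓSpecIso (.of R)).inv ≫
        (Spec (.of R)).presheaf.map (homOfLE le_top).op := by
    rw [Proj.awayMap_awayToSection_assoc, Scheme.Hom.map_appLE,
      ← Category.assoc (CommRingCat.ofHom _), ← awayToSection_pointMap_appLE hl hv htop, Category.assoc, Scheme.Hom.appLE_map]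
  have hGd : G ∈ grading n (d • 1) := (mem_homogeneousSubmodule _ _).2 (by simpa using hG)
  have e3 : HomogeneousLocalization.awayMap (grading n) hl rfl
        (HomogeneousLocalization.Away.mk (grading n) (X_mem n j) d G hGd) =
      HomogeneousLocalization.awayMap (grading n) (X_mem n j) (mul_comm (X j) l)
        (HomogeneousLocalization.Away.mk (grading n) hl d G hGd) *
      HomogeneousLocalization.Away.mk (grading n) (SetLike.mul_mem_graded (X_mem n j) hl) 1 (l ^ 2)
        (SetLike.pow_mem_graded 2 hl) ^ d := by
    rw [HomogeneousLocalization.awayMap_mk, HomogeneousLocalization.awayMap_mk]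
    apply HomogeneousLocalization.val_injective
    simp only [HomogeneousLocalization.val_mul, HomogeneousLocalization.val_pow,
      HomogeneousLocalization.Away.val_mk, Localization.mk_pow, Localization.mk_mul]
    rw [Localization.mk_eq_mk_iff, Localization.r_iff_exists]
    refine ⟨1, ?_⟩
    simp
    ring
  have h1 := congrArg (fun f => f.hom
    (HomogeneousLocalization.Away.mk (grading n) (X_mem n j) d G hGd)) e1
  have h2 := congrArg (fun f => f.hom (HomogeneousLocalization.Away.mk (grading n) hl d G hGd)) e2
  simp only [CommRingCat.hom_comp, RingHom.comp_apply, CommRingCat.hom_ofHom, evalAway_mk, hGv,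
    map_zero] at h1 h2
  rw [e3, map_mul, h2, zero_mul] at h1
  exact h1

theorem cutOutBy_le_ker {S : Set (PolyRing n)}
    (hS : ∀ (d : ℕ) (G : PolyRing n), G.IsHomogeneous d → G ∈ S → aeval v G = 0) :
    cutOutBy S ≤ (pointMap hl hv).ker :=
  sInf_le fun d G hG hGS j => dehomogenize_mem_ker hl hv hG (hS d G hG hGS) j

/-- The point is an immersion because `evalAway` is surjective, and it is finite over the
separated scheme `ℙⁿ` because `R` is finite over `ℂ`. -/
theorem isClosedImmersion_pointMap [Module.Finite ℂ R]
    (hsurj : Function.Surjective (evalAway hv)) : IsClosedImmersion (pointMap hl hv) := by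
  have : IsClosedImmersion (Spec.map (CommRingCat.ofHom (evalAway hv))) :=
    IsClosedImmersion.spec_of_surjective _ hsurj
  have : IsImmersion (pointMap hl hv) := by
    unfold pointMap
    infer_instance
  have hsep : IsSeparated (structureMap n) := by
    unfold structureMap
    infer_instance
  have hfin : IsFinite (pointMap hl hv ≫ structureMap n) := by
    rw [pointMap_structureMap, IsFinite.SpecMap_iff]
    exact RingHom.finite_algebraMap.2 inferInstance
  have : IsFinite (pointMap hl hv) := .of_comp _ (structureMap n)
  exact .of_isPreimmersion _ (pointMap hl hv).isClosedMap.isClosed_range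

theorem lengthAtLeast_of_le_ker [Module.Finite ℂ R]
    (hsurj : Function.Surjective (evalAway hv)) {Y : (PSpace n).IdealSheafData}
    (hY : Y ≤ (pointMap hl hv).ker) : LengthAtLeast Y (Module.finrank ℂ R) :=
  ⟨_, hY, R, _, _, pointMap hl hv, isClosedImmersion_pointMap hl hv hsurj,
    pointMap_structureMap hl hv, inferInstance, rfl, rfl⟩

theorem ne_zero_of_aeval_ne_zero {f : PolyRing n} {d : ℕ} (hf : f ∈ grading n d) (hd : 0 < d)
    {x : Fin (n + 1) → ℂ} (hfx : aeval x f ≠ 0) : x ≠ 0 := by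
  rintro rfl
  refine hfx ?_
  simpa [hd.ne'] using ((mem_homogeneousSubmodule _ _).1 hf).aeval_smul 0 (0 : Fin (n + 1) → ℂ)

/-- A vector of `ℂⁿ⁺¹` at which forms vanish gives a point of the subscheme cut out by them. -/
theorem exists_mem_support_cutOutBy {S : Set (PolyRing n)} {x : Fin (n + 1) → ℂ}
    (hS : ∀ (d : ℕ) (G : PolyRing n), G.IsHomogeneous d → G ∈ S → aeval x G = 0) {f : PolyRing n}
    {d : ℕ} (hf : f ∈ grading n d) (hd : 0 < d) (hfx : aeval x f ≠ 0) :
    ∃ p ∈ (cutOutBy S).support, p ∈ Proj.basicOpen (grading n) f := by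
  obtain ⟨i, hi⟩ := Function.ne_iff.1 (ne_zero_of_aeval_ne_zero hf hd hfx)
  have hi' : x i ≠ 0 := hi
  have hl : C (x i)⁻¹ * X i ∈ grading n 1 :=
    (mem_homogeneousSubmodule _ _).2 ((isHomogeneous_X ℂ i).C_mul _)
  have hv : aeval x (C (x i)⁻¹ * X i : PolyRing n) = 1 := by simp [hi']
  let o : Spec (.of ℂ) := (⊥ : PrimeSpectrum ℂ)
  refine ⟨pointMap hl hv o, ?_, ?_⟩
  · exact Scheme.IdealSheafData.support_antitone (cutOutBy_le_ker hl hv hS)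
      (Scheme.Hom.range_subset_ker_support _ ⟨o, rfl⟩)
  · change o ∈ pointMap hl hv ⁻¹ᵁ Proj.basicOpen (grading n) f
    rw [pointMap_preimage_basicOpen hl hv hf hd]
    exact fun h => hfx h

end Points

/-! ### Secant lines -/

section Secant

variable {n s : ℕ} {F : Fin (s + 1) → PolyRing n}

/-- If the linear syzygies at `x` and at `u` pair to zero with `F(x) ≠ 0`, then the forms `Fᵢ` are
proportional on the line through `x` and `u`, so that this line meets the subscheme cut out by
them in the zero scheme `Spec ℂ[T] / (Fₖ(u + T x))` of a binary quadratic form. -/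
theorem lengthAtLeast_two (hK : ConditionK 2 F) {x u : Fin (n + 1) → ℂ} {i : Fin (n + 1)}
    (hxi : x i ≠ 0) (hu : u ≠ 0) (hui : u i = 0) {k : Fin (s + 1)} (hk : aeval x (F k) ≠ 0)
    (h : ∀ a ∈ linearSyzygies F, ∑ k, aeval u (a k) * aeval x (F k) = 0) :
    LengthAtLeast (cutOutBy (Set.range F) ⊔ linearSubscheme (Submodule.span ℂ {x, u})) 2 := by
  set q : Polynomial ℂ :=
    aeval (fun j => Polynomial.C (u j) + Polynomial.C (x j) * Polynomial.X) (F k) with hq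
  obtain ⟨hq1, hq2⟩ := (hK.isHomogeneous k).aeval_line u x
  rw [← hq] at hq1 hq2
  rw [← coe_aeval_eq_eval] at hq2
  have hqdeg : q.natDegree = 2 :=
    le_antisymm hq1 (Polynomial.le_natDegree_of_ne_zero (by rw [hq2]; exact hk))
  have hq0 : q ≠ 0 := by
    rintro h0
    simp [h0] at hqdeg
  let v : Fin (n + 1) → AdjoinRoot q :=
    fun j => algebraMap ℂ _ (u j) + algebraMap ℂ _ (x j) * AdjoinRoot.root q
  have hvmk : v = fun j => AdjoinRoot.mk q
      (Polynomial.C (u j) + Polynomial.C (x j) * Polynomial.X) := by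
    ext j
    simp [v, AdjoinRoot.algebraMap_eq]
  have hvq : ∀ G : PolyRing n, aeval v G = AdjoinRoot.mkₐ q (aeval (fun j => Polynomial.C (u j) +
      Polynomial.C (x j) * Polynomial.X) G) := by
    intro G
    rw [← AlgHom.comp_apply, comp_aeval, hvmk]
    rfl
  have hsyz : ∀ a ∈ linearSyzygies F,
      ∑ k, aeval v (a k) * algebraMap ℂ (AdjoinRoot q) (aeval x (F k)) = 0 := by
    intro a ha
    have h1 := h a ha
    have h2 : ∑ k, aeval x (a k) * aeval x (F k) = 0 := by
      simpa using congrArg (aeval x) ha.2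
    rw [← sum_aeval_syzygyRow_mul ha.1] at h1 h2 ⊢
    have hal : ∀ p : PolyRing s, aeval (fun k => algebraMap ℂ (AdjoinRoot q) (aeval x (F k))) p =
        algebraMap ℂ (AdjoinRoot q) (aeval (fun k => aeval x (F k)) p) :=
      fun p => aeval_algebraMap_apply _ _ _
    simp only [hal, v, mul_add, Finset.sum_add_distrib, ← mul_assoc,
      ← Finset.sum_mul, ← map_mul, ← map_sum, h1, h2, map_zero, zero_mul, add_zero]
  have hFk : aeval v (F k) = 0 := by
    rw [hvq, ← hq]
    exact AdjoinRoot.mk_self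
  have hF : ∀ m, aeval v (F m) = 0 := by
    intro m
    have h1 := hK.aeval_mul_comm hsyz m k
    rw [hFk, zero_mul] at h1
    exact (((IsUnit.mk0 _ hk).map (algebraMap ℂ (AdjoinRoot q))).mul_left_eq_zero).1 h1
  obtain ⟨j, hj⟩ := Function.ne_iff.1 hu
  have hj' : u j ≠ 0 := hj
  -- a linear form which vanishes at `x` and takes the value `1` at `u`
  let l : PolyRing n := C (u j)⁻¹ * X j - C ((u j)⁻¹ * x j * (x i)⁻¹) * X i
  have hl : l ∈ grading n 1 := (mem_homogeneousSubmodule _ _).2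
    (((isHomogeneous_X ℂ j).C_mul _).sub ((isHomogeneous_X ℂ i).C_mul _))
  have hlv : aeval v l = 1 := by
    have e1 : (u j)⁻¹ * u j = 1 := inv_mul_cancel₀ hj'
    have e2 : (u j)⁻¹ * x j * (x i)⁻¹ * x i = (u j)⁻¹ * x j := by field_simp
    simp only [l, v, map_sub, map_mul, aeval_C, aeval_X, hui, map_zero, zero_add]
    have e1' := congrArg (algebraMap ℂ (AdjoinRoot q)) e1
    have e2' := congrArg (algebraMap ℂ (AdjoinRoot q)) e2
    simp only [map_mul, map_one] at e1' e2'
    linear_combination e1' - AdjoinRoot.root q * e2'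
  have hsurj : Function.Surjective (evalAway hlv) := by
    rw [← RingHom.range_eq_top, eq_top_iff]
    rintro r -
    obtain ⟨p, rfl⟩ := AdjoinRoot.mk_surjective r
    have hC : ∀ c : ℂ, AdjoinRoot.mk q (Polynomial.C c) ∈ (evalAway hlv).range := fun c =>
      ⟨HomogeneousLocalization.Away.mk (grading n) hl 0 (C c) (by simp), by
        rw [evalAway_mk, aeval_C]; rfl⟩
    have hX : AdjoinRoot.mk q Polynomial.X ∈ (evalAway hlv).range :=
      ⟨HomogeneousLocalization.Away.mk (grading n) hl 1 (C (x i)⁻¹ * X i)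
        ((mem_homogeneousSubmodule _ _).2 ((isHomogeneous_X ℂ i).C_mul _)), by
        rw [evalAway_mk]
        simp only [v, map_mul, aeval_C, aeval_X, hui, map_zero, zero_add, ← mul_assoc]
        rw [← map_mul, inv_mul_cancel₀ hxi, map_one, one_mul, AdjoinRoot.mk_X]⟩
    induction p using Polynomial.induction_on' with
    | add p p' hp hp' => rw [map_add]; exact add_mem hp hp'
    | monomial m c =>
      rw [← Polynomial.C_mul_X_pow_eq_monomial, map_mul, map_pow]
      exact mul_mem (hC c) (pow_mem hX m)
  have hfin : Module.Finite ℂ (AdjoinRoot q) := (AdjoinRoot.powerBasis hq0).finite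
  have hrank : Module.finrank ℂ (AdjoinRoot q) = 2 := by
    rw [(AdjoinRoot.powerBasis hq0).finrank, AdjoinRoot.powerBasis_dim, hqdeg]
  rw [← hrank]
  refine lengthAtLeast_of_le_ker hl hlv hsurj (sup_le ?_ ?_)
  · refine cutOutBy_le_ker hl hlv ?_
    rintro d _ - ⟨m, rfl⟩
    exact hF m
  · refine cutOutBy_le_ker hl hlv ?_
    rintro d G - ⟨hG1, hG⟩
    have hGx := hG x (Submodule.subset_span (by simp))
    have hGu := hG u (Submodule.subset_span (by simp))
    rw [hG1.eq_sum_C_mul_X] at hGx hGu ⊢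
    simp only [map_sum, map_mul, eval_C, eval_X, aeval_C, aeval_X] at hGx hGu ⊢
    simp only [v, mul_add, Finset.sum_add_distrib, ← mul_assoc, ← Finset.sum_mul, ← map_mul,
      ← map_sum, hGx, hGu, map_zero, zero_mul, add_zero]

theorem finrank_span_pair {x u : Fin (n + 1) → ℂ} {i : Fin (n + 1)}
    (hxi : x i ≠ 0) (hu : u ≠ 0) (hui : u i = 0) :
    Module.finrank ℂ (Submodule.span ℂ {x, u}) = 2 := by
  have hli : LinearIndependent ℂ ![x, u] := by
    rw [LinearIndependent.pair_iff]
    intro a b hab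
    have ha : a = 0 := by
      have := congrFun hab i
      simpa [hui, hxi] using this
    subst ha
    exact ⟨rfl, by simpa [hu] using hab⟩
  have := finrank_span_eq_card hli
  rwa [Matrix.range_cons_cons_empty, Fintype.card_fin] at this

/-- The forms `Fₖ Fₖ(P(F))` on `ℂⁿ⁺¹`, where `P` is the vector of maximal minors of a matrix of
`n` linear syzygies. On the open set where one of them does not vanish, `P` inverts
`[F₀ : … : Fₛ]`. -/
def chartForms (F : Fin (s + 1) → PolyRing n) : Set (PolyRing n) :=
  {t | ∃ a : Fin n → Fin (s + 1) → PolyRing n, (∀ r, a r ∈ linearSyzygies F) ∧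
    ∃ k, aeval F (X k * minorForm F a k) = t}

/-- A vector at which `F` does not vanish but all the chart forms do lies on a secant line. -/
theorem exists_secant_line (hK : ConditionK 2 F) {x : Fin (n + 1) → ℂ} (hx : x ≠ 0)
    (ht : ∀ t ∈ chartForms F, aeval x t = 0) {k : Fin (s + 1)} (hk : aeval x (F k) ≠ 0) :
    ∃ W : Submodule ℂ (Fin (n + 1) → ℂ), Module.finrank ℂ W = 2 ∧
      LengthAtLeast (cutOutBy (Set.range F) ⊔ linearSubscheme W) 2 ∧ x ∈ W := by
  obtain ⟨i, hi⟩ := Function.ne_iff.1 hx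
  have hi' : x i ≠ 0 := hi
  obtain ⟨u, hu, hui, hua⟩ := exists_orthogonal_of_syzygyMinor_eq_zero hi' (F := F) <| by
    intro a ha j
    by_contra hj
    have hcomm := aeval_syzygyMinor_mul_comm ha x
    set P := fun j => aeval (fun k => aeval x (F k)) (syzygyMinor a j) with hP
    have hPi : P i ≠ 0 := by
      intro h0
      refine mul_ne_zero hj hi' ?_
      change P j * x i = 0
      rw [← hcomm i j]
      change P i * x j = 0
      rw [h0, zero_mul]
    -- `P` is a nonzero multiple of `x`, so `Fₖ` does not vanish at `P` either
    have hFP : aeval P (F k) ≠ 0 := by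
      intro h0
      have h1 := (hK.isHomogeneous k).aeval_smul (x i) P
      have h2 : (fun j => x i * P j) = fun j => P i * x j := by
        ext j
        rw [mul_comm]
        exact hcomm j i
      rw [h2, (hK.isHomogeneous k).aeval_smul, h0, mul_zero] at h1
      exact mul_ne_zero (pow_ne_zero 2 hPi) hk h1
    have h3 := ht _ ⟨a, ha, k, rfl⟩
    rw [← AlgHom.comp_apply, comp_aeval, map_mul, aeval_X, minorForm,
      aeval_aeval_syzygyMinor] at h3
    exact mul_ne_zero hk hFP h3
  exact ⟨_, finrank_span_pair hi' hu hui, lengthAtLeast_two hK hi' hu hui hk hua,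
    Submodule.subset_span (by simp)⟩

/-- Basic open sets of forms of positive degree form a basis of the topology of `ℙⁿ`: multiply a
homogeneous component of `f` by a coordinate. -/
theorem exists_form_basicOpen_le {p : PSpace n} {f : PolyRing n}
    (hp : p ∈ Proj.basicOpen (grading n) f) : ∃ (g : PolyRing n) (d : ℕ), g ∈ grading n d ∧ 0 < d ∧
      p ∈ Proj.basicOpen (grading n) g ∧
      Proj.basicOpen (grading n) g ≤ Proj.basicOpen (grading n) f := by
  have htop : p ∈ ⨆ i : Fin (n + 1), Proj.basicOpen (grading n) (X i) := by
    rw [Proj.iSup_basicOpen_eq_top]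
    · trivial
    · intro g hg
      rw [← Set.image_univ, mem_ideal_span_X_image]
      intro m hm
      by_contra! h
      have hm0 : m = 0 := Finsupp.ext fun i => h i trivial
      have hg0 := (HomogeneousIdeal.mem_irrelevant_iff _ _).1 hg
      rw [GradedRing.proj_apply] at hg0
      have hg1 := (decomposition.decompose'_apply g 0).symm.trans hg0
      rw [homogeneousComponent_zero, C_eq_zero] at hg1
      exact mem_support_iff.1 hm (hm0 ▸ hg1)
  obtain ⟨i, hi⟩ := TopologicalSpace.Opens.mem_iSup.1 htop
  rw [Proj.basicOpen_eq_iSup_proj, TopologicalSpace.Opens.mem_iSup] at hp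
  obtain ⟨m, hm⟩ := hp
  refine ⟨GradedRing.proj (grading n) m f * X i, m + 1, SetLike.mul_mem_graded ?_ (X_mem n i),
    m.succ_pos, ?_, ?_⟩
  · exact SetLike.coe_mem _
  · rw [Proj.basicOpen_mul]
    exact ⟨hm, hi⟩
  · rw [Proj.basicOpen_mul, Proj.basicOpen_eq_iSup_proj (grading n) f]
    exact inf_le_left.trans (le_iSup (fun m => Proj.basicOpen (grading n)
      (GradedRing.proj (grading n) m f)) m)

/-- The open sets `D₊(t)` of the chart forms `t` cover the complement of the secant variety. -/
theorem mem_secantVariety (hK : ConditionK 2 F) {p : PSpace n}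
    (hp : ∀ t ∈ chartForms F, p ∉ Proj.basicOpen (grading n) t) :
    p ∈ secantVariety (cutOutBy (Set.range F)) := by
  change p ∈ closure _
  rw [(Proj.isBasis_basicOpen (grading n)).mem_closure_iff]
  rintro _ ⟨_, ⟨f, rfl⟩, rfl⟩ hpf
  obtain ⟨g, d, hg, hd, hpg, hgf⟩ := exists_form_basicOpen_le hpf
  -- by the Nullstellensatz, some zero of the chart forms is not a zero of `g`
  obtain ⟨x, hx, hgx⟩ : ∃ x : Fin (n + 1) → ℂ, (∀ t ∈ chartForms F, aeval x t = 0) ∧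
      aeval x g ≠ 0 := by
    by_contra! h
    have h1 : g ∈ (Ideal.span (chartForms F)).radical := by
      rw [← vanishingIdeal_zeroLocus_eq_radical (K := ℂ), mem_vanishingIdeal_iff]
      intro x hx
      rw [zeroLocus_span] at hx
      exact h x hx
    have hle : (Ideal.span (chartForms F)).radical ≤ p.asHomogeneousIdeal.toIdeal := by
      rw [p.isPrime.isRadical.radical_le_iff, Ideal.span_le]
      exact fun t ht => not_not.1 (hp t ht)
    exact hpg (hle h1)
  have hx0 := ne_zero_of_aeval_ne_zero hg hd hgx
  by_cases hF : ∀ k, aeval x (F k) = 0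
  · obtain ⟨y, hy, hyg⟩ := exists_mem_support_cutOutBy (S := Set.range F) (x := x)
      (by rintro d _ - ⟨k, rfl⟩; exact hF k) hg hd hgx
    exact ⟨y, hgf hyg, Or.inl hy⟩
  · push Not at hF
    obtain ⟨k, hk⟩ := hF
    obtain ⟨W, hW, hlen, hxW⟩ := exists_secant_line hK hx0 hx hk
    obtain ⟨y, hy, hyg⟩ := exists_mem_support_cutOutBy (x := x)
      (S := {l | l.IsHomogeneous 1 ∧ ∀ w ∈ W, eval w l = 0})
      (by rintro d G - ⟨-, hG⟩; exact hG x hxW) hg hd hgx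
    exact ⟨y, hgf hyg, Or.inr (Set.mem_iUnion₂.2 ⟨W, hW, Set.mem_iUnion.2 ⟨hlen, hy⟩⟩)⟩

end Secant

/-! ### Immersions and charts of the induced morphism -/

/-- A morphism is an immersion if it is so over each member of a family of open sets of the target
whose preimages cover the source. -/
theorem isImmersion_of_iSup_preimage_eq_top {Y Z : Scheme} (f : Y ⟶ Z) {ι : Type} (V : ι → Z.Opens)
    (hV : ⨆ i, f ⁻¹ᵁ V i = ⊤) (h : ∀ i, IsImmersion ((f ⁻¹ᵁ V i).ι ≫ f)) : IsImmersion f := by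
  have hrange : Set.range f ⊆ Set.range (⨆ i, V i).ι := by
    rintro _ ⟨y, rfl⟩
    have hy : y ∈ ⨆ i, f ⁻¹ᵁ V i := hV ▸ trivial
    obtain ⟨i, hi⟩ := TopologicalSpace.Opens.mem_iSup.1 hy
    rw [Scheme.Opens.range_ι]
    exact TopologicalSpace.Opens.mem_iSup.2 ⟨i, hi⟩
  obtain ⟨g, hg⟩ : ∃ g : Y ⟶ (⨆ i, V i).toScheme, g ≫ (⨆ i, V i).ι = f :=
    ⟨IsOpenImmersion.lift _ f hrange, IsOpenImmersion.lift_fac _ _ _⟩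
  have : IsImmersion g := by
    refine IsZariskiLocalAtTarget.of_iSup_eq_top (P := @IsImmersion)
      (fun i => (⨆ i, V i).ι ⁻¹ᵁ V i) ?_ fun i => ?_
    · refine top_le_iff.1 fun y _ => ?_
      obtain ⟨i, hi⟩ := TopologicalSpace.Opens.mem_iSup.1 y.2
      exact TopologicalSpace.Opens.mem_iSup.2 ⟨i, hi⟩
    · have : IsImmersion
          ((g ∣_ (⨆ i, V i).ι ⁻¹ᵁ V i) ≫ ((⨆ i, V i).ι ⁻¹ᵁ V i).ι ≫ (⨆ i, V i).ι) := by
        rw [morphismRestrict_ι_assoc, hg]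
        subst hg
        exact h i
      exact .of_comp _ (((⨆ i, V i).ι ⁻¹ᵁ V i).ι ≫ (⨆ i, V i).ι)
  rw [← hg]
  infer_instance

section InducedMorphism

universe u

variable {A B σ τ : Type u} [CommRing A] [CommRing B] [SetLike σ A] [SetLike τ B]
  [AddSubgroupClass σ A] [AddSubgroupClass τ B] {𝒜 : ℕ → σ} {ℬ : ℕ → τ}
  [GradedRing 𝒜] [GradedRing ℬ] {ψ : A →+* B} {d : ℕ}

theorem isIso_basicOpenToSpec {t : A} {m : ℕ} (ht : t ∈ 𝒜 m) (hm : 0 < m) :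
    IsIso (Proj.basicOpenToSpec 𝒜 t) := by
  rw [← Proj.basicOpenIsoSpec_hom 𝒜 t ht hm]
  infer_instance

theorem isImmersion_chartMap (hψ : MultipliesDegree 𝒜 ℬ ψ d) (hd : 0 < d) {t : A} {m : ℕ}
    (ht : t ∈ 𝒜 m) (hm : 0 < m) (h : Function.Surjective (awayMapOfDegree hψ t)) :
    IsImmersion (chartMap hψ ht hm) := by
  have := isIso_basicOpenToSpec (hψ m t ht) (Nat.mul_pos hd hm)
  have : IsClosedImmersion (Spec.map (CommRingCat.ofHom (awayMapOfDegree hψ t))) :=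
    IsClosedImmersion.spec_of_surjective _ h
  unfold chartMap
  infer_instance

theorem chartMap_preimage_basicOpen (hψ : MultipliesDegree 𝒜 ℬ ψ d) (hd : 0 < d) {t t' : A}
    {m m' : ℕ} (ht : t ∈ 𝒜 m) (hm : 0 < m) (ht' : t' ∈ 𝒜 m') (hm' : 0 < m') :
    chartMap hψ ht hm ⁻¹ᵁ Proj.basicOpen 𝒜 t' =
      (Proj.basicOpen ℬ (ψ t)).ι ⁻¹ᵁ Proj.basicOpen ℬ (ψ t') := by
  have hι : (Proj.basicOpen ℬ (ψ t)).ι =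
      Proj.basicOpenToSpec ℬ (ψ t) ≫ Proj.awayι ℬ (ψ t) (hψ m t ht) (Nat.mul_pos hd hm) := by
    rw [Proj.awayι, ← Proj.basicOpenIsoSpec_hom ℬ (ψ t) (hψ m t ht) (Nat.mul_pos hd hm),
      Iso.hom_inv_id_assoc]
  have helem : HomogeneousLocalization.Away.isLocalizationElem (hψ m t ht) (hψ m' t' ht') =
      awayMapOfDegree hψ t (HomogeneousLocalization.Away.isLocalizationElem ht ht') ^ d := by
    rw [awayMapOfDegree_mk]
    apply HomogeneousLocalization.val_injective
    simp only [HomogeneousLocalization.val_pow, HomogeneousLocalization.Away.val_mk,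
      Localization.mk_pow, map_pow]
    congr 1
    · rw [← pow_mul, mul_comm]
    · ext
      simp [← pow_mul, mul_comm]
  rw [chartMap, Scheme.Hom.comp_preimage, Scheme.Hom.comp_preimage, hι, Scheme.Hom.comp_preimage,
    Proj.awayι_preimage_basicOpen 𝒜 ht hm ht' hm',
    Proj.awayι_preimage_basicOpen ℬ (hψ m t ht) _ (hψ m' t' ht') (Nat.mul_pos hd hm'), helem,
    PrimeSpectrum.basicOpen_pow _ _ hd]
  rfl

theorem inducedMorphism_preimage_basicOpen {ι : Type} (hψ : MultipliesDegree 𝒜 ℬ ψ d) (hd : 0 < d)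
    (y : ι → A) {m : ι → ℕ} (hy : ∀ i, y i ∈ 𝒜 (m i)) (hm : ∀ i, 0 < m i) {t' : A} {m' : ℕ}
    (ht' : t' ∈ 𝒜 m') (hm' : 0 < m') :
    inducedMorphism hψ y hy hm ⁻¹ᵁ Proj.basicOpen 𝒜 t' =
      (⨆ i, Proj.basicOpen ℬ (ψ (y i))).ι ⁻¹ᵁ Proj.basicOpen ℬ (ψ t') := by
  ext p
  obtain ⟨i, hi⟩ := TopologicalSpace.Opens.mem_iSup.1 p.2
  obtain ⟨q, rfl⟩ : ∃ q, (Proj ℬ).homOfLE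
      (le_iSup (fun i => Proj.basicOpen ℬ (ψ (y i))) i) q = p :=
    ⟨⟨p.1, hi⟩, Subtype.ext (by simp)⟩
  have h1 := congrArg (q ∈ ·) (chartMap_preimage_basicOpen hψ hd (hy i) (hm i) ht' hm')
  rw [← homOfLE_inducedMorphism hψ y hy hm i, Scheme.Hom.comp_preimage] at h1
  have h2 : (Proj.basicOpen ℬ (ψ (y i))).ι = (Proj ℬ).homOfLE
      (le_iSup (fun i => Proj.basicOpen ℬ (ψ (y i))) i) ≫
        (⨆ i, Proj.basicOpen ℬ (ψ (y i))).ι := by simp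
  rw [h2, Scheme.Hom.comp_preimage] at h1
  exact h1.to_iff

/-- The restriction of the induced morphism to an open set of the source is an immersion if the
preimages of the standard affine open sets `D₊(t)` over which `ψ` is surjective on
coordinate rings cover it. -/
theorem isImmersion_homOfLE_inducedMorphism {ι κ : Type} (hψ : MultipliesDegree 𝒜 ℬ ψ d)
    (hd : 0 < d) (y : ι → A) {m : ι → ℕ} (hy : ∀ i, y i ∈ 𝒜 (m i)) (hm : ∀ i, 0 < m i)
    {U : (Proj ℬ).Opens} (hU : U ≤ ⨆ i, Proj.basicOpen ℬ (ψ (y i))) (e : κ → ι) (q : κ → A)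
    {m' : κ → ℕ} (hq : ∀ k, q k ∈ 𝒜 (m' k))
    (hcov : U ≤ ⨆ k, Proj.basicOpen ℬ (ψ (y (e k) * q k)))
    (hsurj : ∀ k, Function.Surjective (awayMapOfDegree hψ (y (e k) * q k))) :
    IsImmersion ((Proj ℬ).homOfLE hU ≫ inducedMorphism hψ y hy hm) := by
  have hpre : ∀ k, ((Proj ℬ).homOfLE hU ≫ inducedMorphism hψ y hy hm) ⁻¹ᵁ
      Proj.basicOpen 𝒜 (y (e k) * q k) = U.ι ⁻¹ᵁ Proj.basicOpen ℬ (ψ (y (e k) * q k)) := by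
    intro k
    rw [Scheme.Hom.comp_preimage, inducedMorphism_preimage_basicOpen hψ hd y hy hm
      (SetLike.mul_mem_graded (hy _) (hq k)) (Nat.add_pos_left (hm _) _), ← Scheme.Hom.comp_preimage,
      Scheme.homOfLE_ι]
  refine isImmersion_of_iSup_preimage_eq_top _ (fun k => Proj.basicOpen 𝒜 (y (e k) * q k)) ?_ ?_
  · refine top_le_iff.1 fun p _ => ?_
    obtain ⟨k, hk⟩ := TopologicalSpace.Opens.mem_iSup.1 (hcov p.2)
    refine TopologicalSpace.Opens.mem_iSup.2 ⟨k, ?_⟩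
    rw [hpre]
    exact hk
  · intro k
    rw [hpre]
    set W := U.ι ⁻¹ᵁ Proj.basicOpen ℬ (ψ (y (e k) * q k))
    have hrange : Set.range (W.ι ≫ U.ι) ⊆
        Set.range (Proj.basicOpen ℬ (ψ (y (e k) * q k))).ι := by
      rintro _ ⟨p, rfl⟩
      rw [Scheme.Opens.range_ι]
      exact p.2
    obtain ⟨j, hj⟩ : ∃ j, j ≫ (Proj.basicOpen ℬ (ψ (y (e k) * q k))).ι = W.ι ≫ U.ι :=
      ⟨IsOpenImmersion.lift _ _ hrange, IsOpenImmersion.lift_fac _ _ _⟩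
    have : IsOpenImmersion (j ≫ (Proj.basicOpen ℬ (ψ (y (e k) * q k))).ι) := by
      rw [hj]
      infer_instance
    have : IsOpenImmersion j := .of_comp _ (Proj.basicOpen ℬ (ψ (y (e k) * q k))).ι
    have hle : Proj.basicOpen ℬ (ψ (y (e k) * q k)) ≤ Proj.basicOpen ℬ (ψ (y (e k))) := by
      rw [map_mul, Proj.basicOpen_mul]
      exact inf_le_left
    have hfac : W.ι ≫ (Proj ℬ).homOfLE hU ≫ inducedMorphism hψ y hy hm =
        j ≫ chartMap hψ (SetLike.mul_mem_graded (hy (e k)) (hq k)) (Nat.add_pos_left (hm _) _) := by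
      rw [← homOfLE_chartMap hψ (hy _) (hm _) (hq k) hle, ← homOfLE_inducedMorphism hψ y hy hm]
      simp only [← Category.assoc]
      congr 1
      rw [← cancel_mono (⨆ i, Proj.basicOpen ℬ (ψ (y i))).ι]
      simp [hj]
    have := isImmersion_chartMap hψ hd (SetLike.mul_mem_graded (hy (e k)) (hq k))
      (Nat.add_pos_left (hm _) _) (hsurj k)
    rw [hfac]
    infer_instance

end InducedMorphism

end SecantEmbedding

theorem mainTheorem5 {n s : ℕ} (X : (PSpace n).IdealSheafData) (F : Fin (s + 1) → PolyRing n)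
    (hX : X = cutOutBy (Set.range F)) (hK : ConditionK 2 F) :
    ∃ h : (secantVariety X).compl ≤ nonvanishing F,
      IsImmersion ((PSpace n).homOfLE h ≫ phi F hK.isHomogeneous) := by
  subst hX
  have hcov : ∀ p ∈ (secantVariety (cutOutBy (Set.range F))).compl,
      ∃ t ∈ chartForms F, p ∈ Proj.basicOpen (grading n) t := by
    intro p hp
    by_contra! h
    exact hp (mem_secantVariety hK h)
  refine ⟨fun p hp => ?_, ?_⟩
  · obtain ⟨_, ⟨a, -, k, rfl⟩, hpt⟩ := hcov p hp
    rw [map_mul, Proj.basicOpen_mul] at hpt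
    exact TopologicalSpace.Opens.mem_iSup.2 ⟨k, hpt.1⟩
  · refine isImmersion_homOfLE_inducedMorphism
      (κ := {a : Fin n → Fin (s + 1) → PolyRing n // ∀ r, a r ∈ linearSyzygies F} × Fin (s + 1))
      (multipliesDegree_aeval hK.isHomogeneous) two_pos _ (X_mem s) _ _ (fun c => c.2)
      (fun c => minorForm F c.1.1 c.2) (fun c => minorForm_mem hK.isHomogeneous c.1.1 c.2) ?_
      (fun c => awayMapOfDegree_surjective hK.isHomogeneous c.1.2 c.2)
    intro p hp
    obtain ⟨_, ⟨a, ha, k, rfl⟩, hpt⟩ := hcov p hp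
    exact TopologicalSpace.Opens.mem_iSup.2 ⟨(⟨a, ha⟩, k), hpt⟩
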